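/- Let $S$ be a smooth two-dimensional manifold with a smooth Riemannian metric $\gamma=\gamma_{AB}dx^Adx^B$ of constant scalar curvature $2\varepsilon$, $\varepsilon\in\{0,\pm1\}$, and Levi-Civita derivative $D$. Let $\Lambda,m\in\mathbb R$ be arbitrary, put $\alpha^2:=\Lambda/3$ (negative if $\Lambda<0$) and $$V(r):=\varepsilon r-\alpha^2r^3-2m ,$$ so that $-\frac{V}{r}du^2-2\,du\,dr+r^2\gamma_{AB}dx^Adx^B$ is a Birmingham--Kottler metric. For a two-covariant tensor field $X$ on $S$ write $\mathrm{TS}[X_{AB}]=\frac12(X_{AB}+X_{BA}-\gamma^{CD}X_{CD}\gamma_{AB})$ and $PX_{AB}:=\mathrm{TS}[D_AD^CX_{BC}]$. Let $J\subset\mathbb R$ and $I\subset(0,\infty)$ be open. Consider a linearised perturbation $h$ of this metric, smooth on $\{u\in J,\ r\in I\}$, in the Bondi gauge $h_{rr}=h_{rA}=\gamma^{AB}h_{AB}=0$ and with $\delta\beta=-\frac12h_{ur}=0$; put $\check h_{\mu\nu}:=h_{\mu\nu}/r^2$. In this gauge the linearised vacuum equations $\delta G_{rA}=0$ and $\mathrm{TS}[\delta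 G_{AB}]=0$ read $$\partial_r\big[r^4\partial_r\check h_{uA}\big]=D^B\big[r^2\partial_r\check h_{AB}\big],\tag{1}$$ $$0=\partial_r\Big[r\partial_u\check h_{AB}-\tfrac12V\partial_r\check h_{AB}-\tfrac{V}{2r}\check h_{AB}-r\,\mathrm{TS}[D_A\check h_{uB}]\Big]+\tfrac12\,\partial_r\!\big(\tfrac Vr\big)\,\check h_{AB}-\mathrm{TS}[D_A\check h_{uB}].\tag{2}$$ For an integer $i\ge0$ define the covector fields $$Q^{3,i+1}_A:=D^B\Big[2r\,\partial_u^{i+1}\check h_{AB}-V\partial_r\partial_u^i\check h_{AB}-\tfrac1{r^2}\partial_r\big(r^4\,\mathrm{TS}[D_A\partial_u^i\check h_{uB}]\big)+(P-\varepsilon)\partial_u^i\check h_{AB}\Big]+\alpha^2r^4\partial_r\partial_u^i\check h_{uA}+2m\big(3\,\partial_u^i\check h_{uA}+r\,\partial_r\partial_u^i\check h_{uA}\big).$$ Let $i\ge0$, $u_0\in J$ and $R\subset I$, and suppose that the $i$-th $u$-derivatives of (1) and of (2) hold at $u=u_0$ for all $r\in R$, at all points of the domain of a local coordinate system $(x^A)$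 of $S$. Then, on that coordinate domain, $$\partial_rQ^{3,i+1}_A=0\qquad\text{at }u=u_0,\ \text{for all } r\in R .$$ In particular, if the $i$-th $u$-derivatives of (1) and (2) hold on a null hypersurface $\{u=u_0,\ r\in R\}$ (all of $S$, $R$ an interval), then $Q^{3,i+1}_A$ is radially constant along it, for all values of $\Lambda$ and $m$. -/

import Mathlib

open scoped Manifold ContDiff Bundle

noncomputable section

namespace BondiGluing

/-- The model plane in which the local coordinates `x^A`, `A = 0, 1`, take their values. -/
abbrev Plane : Type := EuclideanSpace ℝ (Fin 2)

/-! ### Tensor calculus of a two-dimensional metric in local coordinates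

Components of a covector field `w_A` and of a two-covariant tensor field `t_{AB}` in a coordinate
system are functions of the coordinates `p`. The metric components are denoted by `G`. -/

/-- Components of a covector field in local coordinates. -/
abbrev Covec : Type := Fin 2 → Plane → ℝ

/-- Components of a two-covariant tensor field in local coordinates. -/
abbrev Tensor2 : Type := Fin 2 → Fin 2 → Plane → ℝ

/-- The coordinate derivative `∂_A f`. -/
def pd (A : Fin 2) (f : Plane → ℝ) (p : Plane) : ℝ :=
  fderiv ℝ f p (EuclideanSpace.single A 1)

/-- The inverse metric `γ^{AB}`. -/
def invMetric (G : Tensor2) (A B : Fin 2) (p : Plane) : ℝ :=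
  (Matrix.of fun C D : Fin 2 => G C D p)⁻¹ A B

/-- The Christoffel symbols
`Γ^C_{AB} = ½ γ^{CD} (∂_A γ_{DB} + ∂_B γ_{DA} - ∂_D γ_{AB})` of the Levi-Civita connection. -/
def christoffel (G : Tensor2) (C A B : Fin 2) (p : Plane) : ℝ :=
  (1 / 2) * ∑ D, invMetric G C D p * (pd A (G D B) p + pd B (G D A) p - pd D (G A B) p)

/-- The Ricci tensor
`R_{AB} = ∂_C Γ^C_{AB} - ∂_B Γ^C_{AC} + Γ^C_{CD} Γ^D_{AB} - Γ^C_{BD} Γ^D_{AC}`. -/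
def ricci (G : Tensor2) (A B : Fin 2) (p : Plane) : ℝ :=
  ∑ C, (pd C (christoffel G C A B) p - pd B (christoffel G C A C) p
    + ∑ D, (christoffel G C C D p * christoffel G D A B p
        - christoffel G C B D p * christoffel G D A C p))

/-- The scalar curvature `γ^{AB} R_{AB}`. -/
def scalarCurvature (G : Tensor2) (p : Plane) : ℝ :=
  ∑ A, ∑ B, invMetric G A B p * ricci G A B p

/-- The covariant derivative `D_A w_B` of a covector field. -/
def covD (G : Tensor2) (w : Covec) : Tensor2 := fun A B p =>
  pd A (w B) p - ∑ C, christoffel G C A B p * w C p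

/-- The covariant derivative `D_C t_{AB}` of a two-covariant tensor field. -/
def covD₂ (G : Tensor2) (t : Tensor2) (C A B : Fin 2) (p : Plane) : ℝ :=
  pd C (t A B) p
    - ∑ D, christoffel G D C A p * t D B p - ∑ D, christoffel G D C B p * t A D p

/-- The divergence `D^B t_{AB}`. -/
def div₂ (G : Tensor2) (t : Tensor2) : Covec := fun A p =>
  ∑ B, ∑ C, invMetric G B C p * covD₂ G t C A B p

/-- The trace `γ^{AB} t_{AB}`. -/
def trace (G : Tensor2) (t : Tensor2) (p : Plane) : ℝ :=
  ∑ A, ∑ B, invMetric G A B p * t A B p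

/-- The traceless symmetric part `TS[t_{AB}] = ½ (t_{AB} + t_{BA} - γ^{CD} t_{CD} γ_{AB})`. -/
def TS (G : Tensor2) (t : Tensor2) : Tensor2 := fun A B p =>
  (1 / 2) * (t A B p + t B A p - trace G t p * G A B p)

/-- The operator `(P t)_{AB} = TS[D_A D^C t_{BC}]`. -/
def opP (G : Tensor2) (t : Tensor2) : Tensor2 := TS G (covD G (div₂ G t))

/-! ### Components of tensor fields on a surface -/

section Surface

variable {S : Type*} [TopologicalSpace S] [ChartedSpace Plane S]

/-- The coordinate vector `∂_A` of the coordinate system `φ`, at the point with coordinates `p`. -/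
def coordVec (φ : OpenPartialHomeomorph S Plane) (A : Fin 2) (p : Plane) :
    TangentSpace (𝓡 2) (φ.symm p) :=
  letI : ChartedSpace Plane Plane := chartedSpaceSelf Plane
  mfderiv 𝓘(ℝ, Plane) (𝓡 2) φ.symm p (EuclideanSpace.single A (1 : ℝ) : Plane)

/-- The components `w_A = w(∂_A)` of a covector field on `S` in the coordinate system `φ`. -/
def comp₁ (φ : OpenPartialHomeomorph S Plane)
    (w : (x : S) → TangentSpace (𝓡 2) x →L[ℝ] ℝ) : Covec := fun A p =>
  w (φ.symm p) (coordVec φ A p)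

/-- The components `t_{AB} = t(∂_A, ∂_B)` of a two-covariant tensor field on `S` in the
coordinate system `φ`. -/
def comp₂ (φ : OpenPartialHomeomorph S Plane)
    (t : (x : S) → TangentSpace (𝓡 2) x →L[ℝ] TangentSpace (𝓡 2) x →L[ℝ] ℝ) : Tensor2 :=
  fun A B p => t (φ.symm p) (coordVec φ A p) (coordVec φ B p)

variable (S) [IsManifold (𝓡 2) ∞ S]

/-- The data of a Birmingham-Kottler metric
`g = -(ε - α² r² - 2m/r) du² - 2 du dr + r² γ_{AB} dx^A dx^B`, `α² = Λ/3`, with cross-sections `S`: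
a smooth Riemannian metric `γ` on the surface `S` of constant scalar curvature `2ε`,
`ε ∈ {-1, 0, 1}`, a cosmological constant `Λ ∈ ℝ` and a mass parameter `m ∈ ℝ`. -/
structure Background where
  γ : Bundle.ContMDiffRiemannianMetric (𝓡 2) ∞ Plane
    (fun x : S => TangentSpace (𝓡 2) x)
  ε : ℝ
  ε_mem : ε = -1 ∨ ε = 0 ∨ ε = 1
  Λ : ℝ
  m : ℝ
  scalarCurvature_eq : ∀ φ ∈ IsManifold.maximalAtlas (𝓡 2) ∞ S, ∀ p ∈ φ.target,
    scalarCurvature (comp₂ φ γ.inner) p = 2 * ε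

namespace Background

variable {S} (b : Background S)

/-- The components `γ_{AB}` of the metric of the cross-sections. -/
def G (φ : OpenPartialHomeomorph S Plane) : Tensor2 := comp₂ φ b.γ.inner

/-- The constant `α² = Λ / 3`; it is negative when `Λ < 0`. -/
def αsq : ℝ := b.Λ / 3

/-- The background Bondi function `V = ε r - α² r³ - 2m`. -/
def V (r : ℝ) : ℝ := b.ε * r - b.αsq * r ^ 3 - 2 * b.m

end Background

variable {S}

/-- A smooth linearised metric perturbation `h` of a Birmingham-Kottler background, in Bondi gauge
`h_{rr} = h_{rA} = γ^{AB} h_{AB} = 0` with in addition `δβ = -h_{ur} / 2 = 0`, over the range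
`u ∈ J`, `r ∈ I` of the coordinates. Only `h_{uA}` and `h_{AB}` are recorded (`h_{uu}` does not
enter the equations considered). For each `(u, r)` these are tensor fields on `S`; they are smooth
in the sense that in each coordinate system of `S` their components are smooth functions of
`(u, r, x^A)`. Values outside of `J × I` are irrelevant. -/
structure BondiPerturbation (b : Background S) (J I : Set ℝ) where
  hu : ℝ → ℝ → (x : S) → TangentSpace (𝓡 2) x →L[ℝ] ℝ
  hS : ℝ → ℝ → (x : S) → TangentSpace (𝓡 2) x →L[ℝ] TangentSpace (𝓡 2) x →L[ℝ] ℝ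
  symm : ∀ u ∈ J, ∀ r ∈ I, ∀ (x : S) (v w : TangentSpace (𝓡 2) x), hS u r x v w = hS u r x w v
  traceless : ∀ u ∈ J, ∀ r ∈ I, ∀ φ ∈ IsManifold.maximalAtlas (𝓡 2) ∞ S, ∀ p ∈ φ.target,
    trace (b.G φ) (comp₂ φ (hS u r)) p = 0
  smooth_hu : ∀ φ ∈ IsManifold.maximalAtlas (𝓡 2) ∞ S, ∀ A : Fin 2,
    ContDiffOn ℝ ∞ (fun y : ℝ × ℝ × Plane => comp₁ φ (hu y.1 y.2.1) A y.2.2)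
      (J ×ˢ I ×ˢ φ.target)
  smooth_hS : ∀ φ ∈ IsManifold.maximalAtlas (𝓡 2) ∞ S, ∀ A B : Fin 2,
    ContDiffOn ℝ ∞ (fun y : ℝ × ℝ × Plane => comp₂ φ (hS y.1 y.2.1) A B y.2.2)
      (J ×ˢ I ×ˢ φ.target)

namespace BondiPerturbation

variable {b : Background S} {J I : Set ℝ} (h : BondiPerturbation b J I)
  (φ : OpenPartialHomeomorph S Plane)

/-- The components `h_{uA}` in the coordinate system `φ`. -/
def huA (u r : ℝ) : Covec := comp₁ φ (h.hu u r)

/-- The components `h_{AB}` in the coordinate system `φ`. -/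
def hAB (u r : ℝ) : Tensor2 := comp₂ φ (h.hS u r)

/-- The rescaled components `ȟ_{uA} = h_{uA} / r²`. -/
def chkuA (u r : ℝ) : Covec := fun A p => h.huA φ u r A p / r ^ 2

/-- The rescaled components `ȟ_{AB} = h_{AB} / r²`. -/
def chkAB (u r : ℝ) : Tensor2 := fun A B p => h.hAB φ u r A B p / r ^ 2

/-- The `u`-derivatives `∂_u^i ȟ_{uA}`. -/
def duChkuA (i : ℕ) (u r : ℝ) : Covec := fun A p =>
  iteratedDeriv i (fun v => h.chkuA φ v r A p) u

/-- The `u`-derivatives `∂_u^i ȟ_{AB}`. -/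
def duChkAB (i : ℕ) (u r : ℝ) : Tensor2 := fun A B p =>
  iteratedDeriv i (fun v => h.chkAB φ v r A B p) u

/-- Left-hand side minus right-hand side of the linearised vacuum equation `δG_{rA} = 0` in the
gauge `δβ = 0`, namely `∂_r [r⁴ ∂_r (r⁻² h_{uA})] = D^B [r² ∂_r (r⁻² h_{AB})]`. -/
def eqRA (u r : ℝ) : Covec := fun A p =>
  deriv (fun s => s ^ 4 * deriv (fun t => h.chkuA φ u t A p) s) r
    - div₂ (b.G φ) (fun C B q => r ^ 2 * deriv (fun s => h.chkAB φ u s C B q) r) A p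

/-- Right-hand side of the linearised vacuum equation `0 = r⁻¹ TS[δG_{AB}]` in the gauge `δβ = 0`:
`∂_r [r ∂_u ȟ_{AB} - ½ V ∂_r ȟ_{AB} - (V / 2r) ȟ_{AB} - r TS[D_A ȟ_{uB}]]
  + ½ ∂_r (V / r) ȟ_{AB} - r⁻¹ (r TS[D_A ȟ_{uB}])`. -/
def eqTS (u r : ℝ) : Tensor2 := fun A B p =>
  deriv (fun s =>
      s * deriv (fun v => h.chkAB φ v s A B p) u
        - (1 / 2) * b.V s * deriv (fun t => h.chkAB φ u t A B p) s
        - b.V s / (2 * s) * h.chkAB φ u s A B p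
        - s * TS (b.G φ) (covD (b.G φ) (h.chkuA φ u s)) A B p) r
    + (1 / 2) * deriv (fun s => b.V s / s) r * h.chkAB φ u r A B p
    - r⁻¹ * (r * TS (b.G φ) (covD (b.G φ) (h.chkuA φ u r)) A B p)

/-- The covector field `Q^{3,i+1}_A`, `i ≥ 0`:
`D^B [2 r ∂_u^{i+1} ȟ_{AB} - V ∂_r ∂_u^i ȟ_{AB} - r⁻² ∂_r (r⁴ TS[D_A ∂_u^i ȟ_{uB}])
    + (P - ε) ∂_u^i ȟ_{AB}]
  + α² r⁴ ∂_r ∂_u^i ȟ_{uA} + 2 m (3 ∂_u^i ȟ_{uA} + r ∂_r ∂_u^i ȟ_{uA})`. -/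
def Q3 (i : ℕ) (u r : ℝ) : Covec := fun A p =>
  div₂ (b.G φ) (fun C B q =>
      2 * r * h.duChkAB φ (i + 1) u r C B q
        - b.V r * deriv (fun s => h.duChkAB φ i u s C B q) r
        - 1 / r ^ 2 *
            deriv (fun s => s ^ 4 * TS (b.G φ) (covD (b.G φ) (h.duChkuA φ i u s)) C B q) r
        + (opP (b.G φ) (h.duChkAB φ i u r) C B q - b.ε * h.duChkAB φ i u r C B q)) A p
    + b.αsq * r ^ 4 * deriv (fun s => h.duChkuA φ i u s A p) r
    + 2 * b.m * (3 * h.duChkuA φ i u r A p + r * deriv (fun s => h.duChkuA φ i u s A p) r)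

end BondiPerturbation

end Surface

end BondiGluing

end

/-! Write `W`, `T`, `T'` for `∂_u^i ȟ_{uA}`, `∂_u^i ȟ_{AB}`, `∂_u^{i+1} ȟ_{AB}`, and let `X` be the
tensor in the bracket of `Q^{3,i+1}`, so that `Q = div X` plus explicit terms in `α²` and `m`. The
operators in both equations have `u`-independent coefficients, so their `i`-th `u`-derivatives are
the same equations for `W`, `T`, `T'`. Expanded in `r`, they read `r⁴ W_rr + 4 r³ W_r = r² div T_r`
and a relation that expresses `T' + r T'_r` through `T` and `W`.

Differentiating `X` produces `2 (T' + r T'_r)`. Eliminating it by the second equation leaves `(V/r -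
ε) T_r + P T_r - TS D(4 r W_r + r² W_rr)`. By the first equation `div T_r = 4 r W_r + r² W_rr`, and
since `P = TS D div` the last two terms cancel (`pr_chargeTensor`). Thus `∂_r X = (-α² r² - 2m/r)
T_r`. Taking the divergence and using the first equation again gives `-∂_r [α² r⁴ W_r + 2m (3 W + r
W_r)]`, exactly opposite to the derivative of the explicit terms in `Q` (`hasDerivAt_Q3`).

No two covariant derivatives are interchanged. The analytic work is smoothness of the coordinate
components and commutation of `∂_u`, `∂_r`, `∂_A`. The `r`-derivatives of the equations are never
used, so `R` may be any subset of `I`; angular derivatives of the first equation are used, so it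
must hold on the whole coordinate domain. -/

noncomputable section

namespace BondiGluing

/-! ### Smoothness and nondegeneracy of the metric components in a chart. -/

section MetricComponents

variable {S : Type*} [TopologicalSpace S] [ChartedSpace Plane S] [IsManifold (𝓡 2) ∞ S]

/-- The coordinate frame is the tangent map of the smooth inverse chart applied to a constant
section of the tangent bundle of the plane. -/
theorem contMDiffOn_coordVec (φ : OpenPartialHomeomorph S Plane)
    (hφ : φ ∈ IsManifold.maximalAtlas (𝓡 2) ∞ S) (A : Fin 2) :
    ContMDiffOn 𝓘(ℝ, Plane) ((𝓡 2).prod 𝓘(ℝ, Plane)) ∞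
      (fun p => Bundle.TotalSpace.mk' Plane (E := fun x : S => TangentSpace (𝓡 2) x)
        (φ.symm p) (coordVec φ A p)) φ.target := by
  have h1 := contMDiffOn_symm_of_mem_maximalAtlas hφ
  have h2 := h1.contMDiffOn_tangentMapWithin (m := ∞) (by simp)
    φ.open_target.uniqueMDiffOn
  have h3 : ContMDiffOn 𝓘(ℝ, Plane) ((𝓡 2).prod 𝓘(ℝ, Plane)) ∞
      (fun p : Plane => Bundle.TotalSpace.mk' Plane
        (E := fun x : Plane => TangentSpace (𝓡 2) x) p
        (EuclideanSpace.single A (1 : ℝ) : Plane)) φ.target :=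
    contMDiffOn_vectorSpace_iff_contDiffOn.2 contDiffOn_const
  refine (h2.comp h3 fun p hp => hp).congr fun p hp => ?_
  simp only [Function.comp_apply, tangentMapWithin, coordVec]
  rw [mfderivWithin_of_isOpen φ.open_target hp]

theorem contDiffOn_G (b : Background S) (φ : OpenPartialHomeomorph S Plane)
    (hφ : φ ∈ IsManifold.maximalAtlas (𝓡 2) ∞ S) (A B : Fin 2) :
    ContDiffOn ℝ ∞ (b.G φ A B) φ.target := by
  have h0 := (b.γ.contMDiff.comp_contMDiffOn (contMDiffOn_symm_of_mem_maximalAtlas hφ))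
  have h1 := ContMDiffOn.clm_bundle_apply₂ (E₃ := fun _ : S => ℝ) (F₃ := ℝ) h0
    (contMDiffOn_coordVec φ hφ A) (contMDiffOn_coordVec φ hφ B)
  rw [← contMDiffOn_iff_contDiffOn]
  intro p hp
  have h2 := h1 p hp
  rw [Bundle.contMDiffWithinAt_totalSpace] at h2
  exact h2.2

omit [IsManifold (𝓡 2) ∞ S] in
theorem sum_smul_coordVec (φ : OpenPartialHomeomorph S Plane) (v : Fin 2 → ℝ) (p : Plane) :
    ∑ A, v A • coordVec φ A p =
      mfderiv 𝓘(ℝ, Plane) (𝓡 2) φ.symm p (WithLp.toLp 2 v : Plane) := by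
  have h : (WithLp.toLp 2 v : Plane) = ∑ A, v A • (EuclideanSpace.single A (1 : ℝ) : Plane) := by
    ext i
    fin_cases i <;> simp
  erw [h, map_sum]
  refine Finset.sum_congr rfl fun A _ => ?_
  erw [map_smul]
  rfl

/-- A kernel vector of the Gram matrix would be the coordinate vector of some `X` with `γ(X, X) =
0`. Positivity forces `X = 0`, and the differential of the inverse chart is injective. -/
theorem det_G_ne_zero (b : Background S) (φ : OpenPartialHomeomorph S Plane)
    (hφ : φ ∈ IsManifold.maximalAtlas (𝓡 2) ∞ S) {p : Plane} (hp : p ∈ φ.target) :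
    (Matrix.of fun C D : Fin 2 => b.G φ C D p).det ≠ 0 := by
  intro hdet
  obtain ⟨v, hv, hMv⟩ := Matrix.exists_mulVec_eq_zero_iff.2 hdet
  set X : TangentSpace (𝓡 2) (φ.symm p) := ∑ A, v A • coordVec φ A p with hX
  have hXX : b.γ.inner (φ.symm p) X X = 0 := by
    have h0 := congrFun hMv 0
    have h1 := congrFun hMv 1
    simp only [Matrix.mulVec, dotProduct, Fin.sum_univ_two, Matrix.of_apply, Background.G, comp₂,
      Pi.zero_apply] at h0 h1
    simp only [hX, Fin.sum_univ_two, map_add, map_smul, add_apply,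
      smul_apply, smul_eq_mul]
    linear_combination v 0 * h0 + v 1 * h1
  have hX0 : X = 0 := by
    by_contra hne
    exact (b.γ.pos _ X hne).ne' hXX
  have hmd : φ.MDifferentiable (𝓡 2) (𝓡 2) :=
    ⟨(contMDiffOn_of_mem_maximalAtlas hφ).mdifferentiableOn (by simp),
      (contMDiffOn_symm_of_mem_maximalAtlas hφ).mdifferentiableOn (by simp)⟩
  rw [hX, sum_smul_coordVec] at hX0
  have hid := DFunLike.congr_fun (hmd.comp_symm_deriv hp) (WithLp.toLp 2 v : Plane)
  have hz : (WithLp.toLp 2 v : Plane) = 0 :=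
    hid.symm.trans ((congrArg (mfderiv (𝓡 2) (𝓡 2) φ (φ.symm p)) hX0).trans (map_zero _))
  apply hv
  simpa using congrArg WithLp.ofLp hz

end MetricComponents

/-! ### Smoothness of the inverse metric and Christoffel symbols. -/

theorem contDiffOn_pd {U : Set Plane} (hU : IsOpen U) {f : Plane → ℝ} (hf : ContDiffOn ℝ ∞ f U)
    (A : Fin 2) : ContDiffOn ℝ ∞ (pd A f) U :=
  (hf.fderiv_of_isOpen hU (by simp)).clm_apply contDiffOn_const

/-- A metric in local coordinates on `U` with smooth, nondegenerate components. -/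
structure IsSmoothMetricOn (G : Tensor2) (U : Set Plane) : Prop where
  contDiffOn : ∀ A B, ContDiffOn ℝ ∞ (G A B) U
  det_ne_zero : ∀ p ∈ U, (Matrix.of fun C D : Fin 2 => G C D p).det ≠ 0

namespace IsSmoothMetricOn

variable {G : Tensor2} {U : Set Plane}

theorem contDiffOn_invMetric (hG : IsSmoothMetricOn G U) (A B : Fin 2) :
    ContDiffOn ℝ ∞ (invMetric G A B) U := by
  have hd : ContDiffOn ℝ ∞ (fun p => (Matrix.of fun C D : Fin 2 => G C D p).det) U := by
    simp only [Matrix.det_fin_two, Matrix.of_apply]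
    exact ((hG.contDiffOn 0 0).mul (hG.contDiffOn 1 1)).sub
      ((hG.contDiffOn 0 1).mul (hG.contDiffOn 1 0))
  have ha : ContDiffOn ℝ ∞ (fun p => (Matrix.of fun C D : Fin 2 => G C D p).adjugate A B) U := by
    simp only [Matrix.adjugate_fin_two, Matrix.of_apply]
    fin_cases A <;> fin_cases B
    exacts [hG.contDiffOn 1 1, (hG.contDiffOn 0 1).neg, (hG.contDiffOn 1 0).neg,
      hG.contDiffOn 0 0]
  -- Cramer's rule: the inverse is the adjugate divided by the determinant.
  refine ((hd.inv hG.det_ne_zero).mul ha).congr fun p _ => ?_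
  simp [invMetric, Matrix.inv_def]

theorem contDiffOn_christoffel (hG : IsSmoothMetricOn G U) (hU : IsOpen U) (C A B : Fin 2) :
    ContDiffOn ℝ ∞ (christoffel G C A B) U :=
  contDiffOn_const.mul <| ContDiffOn.sum fun D _ => (hG.contDiffOn_invMetric C D).mul <|
    ((contDiffOn_pd hU (hG.contDiffOn D B) A).add (contDiffOn_pd hU (hG.contDiffOn D A) B)).sub
      (contDiffOn_pd hU (hG.contDiffOn A B) D)

end IsSmoothMetricOn

theorem Background.isSmoothMetricOn_G {S : Type*} [TopologicalSpace S] [ChartedSpace Plane S]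
    [IsManifold (𝓡 2) ∞ S] (b : Background S) (φ : OpenPartialHomeomorph S Plane)
    (hφ : φ ∈ IsManifold.maximalAtlas (𝓡 2) ∞ S) : IsSmoothMetricOn (b.G φ) φ.target :=
  ⟨contDiffOn_G b φ hφ, fun _ hp => det_G_ne_zero b φ hφ hp⟩

/-! ### Smooth functions of `(u, r, x^A)` and symmetry of their mixed partial derivatives. -/

/-- The partial derivative `∂_u f` of a function `f` of `(u, r, x^A)`. -/
def pu (f : ℝ → ℝ → Plane → ℝ) (u r : ℝ) (p : Plane) : ℝ := deriv (fun v => f v r p) u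

/-- The partial derivative `∂_r f` of a function `f` of `(u, r, x^A)`. -/
def pr (f : ℝ → ℝ → Plane → ℝ) (u r : ℝ) (p : Plane) : ℝ := deriv (fun s => f u s p) r

/-- The derivative of a function of `(u, r, x^A)` in a fixed direction. -/
def dirDeriv (v : ℝ × ℝ × Plane) (f : ℝ → ℝ → Plane → ℝ) (u r : ℝ) (p : Plane) : ℝ :=
  fderiv ℝ (fun y : ℝ × ℝ × Plane => f y.1 y.2.1 y.2.2) (u, r, p) v

/-- Smoothness of a function of `(u, r, x^A)` on `J × I × U`. -/
def SmoothField (J I : Set ℝ) (U : Set Plane) (f : ℝ → ℝ → Plane → ℝ) : Prop :=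
  ContDiffOn ℝ ∞ (fun y : ℝ × ℝ × Plane => f y.1 y.2.1 y.2.2) (J ×ˢ I ×ˢ U)

namespace SmoothField

variable {J I : Set ℝ} {U : Set Plane} {f g : ℝ → ℝ → Plane → ℝ}

theorem congr (hf : SmoothField J I U f)
    (h : ∀ u ∈ J, ∀ r ∈ I, ∀ p ∈ U, g u r p = f u r p) : SmoothField J I U g :=
  ContDiffOn.congr hf fun _ hy => h _ hy.1 _ hy.2.1 _ hy.2.2

theorem of_radial {c : ℝ → ℝ} (hc : ContDiffOn ℝ ∞ c I) : SmoothField J I U fun _ r _ => c r :=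
  hc.comp (contDiff_fst.comp contDiff_snd).contDiffOn fun _ hy => hy.2.1

theorem of_angular {c : Plane → ℝ} (hc : ContDiffOn ℝ ∞ c U) :
    SmoothField J I U fun _ _ p => c p :=
  hc.comp (contDiff_snd.comp contDiff_snd).contDiffOn fun _ hy => hy.2.2

theorem add (hf : SmoothField J I U f) (hg : SmoothField J I U g) :
    SmoothField J I U fun u r p => f u r p + g u r p := ContDiffOn.add hf hg

theorem sub (hf : SmoothField J I U f) (hg : SmoothField J I U g) :
    SmoothField J I U fun u r p => f u r p - g u r p := ContDiffOn.sub hf hg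

theorem mul (hf : SmoothField J I U f) (hg : SmoothField J I U g) :
    SmoothField J I U fun u r p => f u r p * g u r p := ContDiffOn.mul hf hg

theorem sum {ι : Type*} {s : Finset ι} {F : ι → ℝ → ℝ → Plane → ℝ}
    (hF : ∀ i ∈ s, SmoothField J I U (F i)) : SmoothField J I U fun u r p => ∑ i ∈ s, F i u r p :=
  ContDiffOn.sum hF

section Derivatives

variable (hJ : IsOpen J) (hI : IsOpen I) (hU : IsOpen U)
include hJ hI hU

theorem contDiffAt (hf : SmoothField J I U f) {u r : ℝ} {p : Plane} (hu : u ∈ J) (hr : r ∈ I)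
    (hp : p ∈ U) : ContDiffAt ℝ ∞ (fun y : ℝ × ℝ × Plane => f y.1 y.2.1 y.2.2) (u, r, p) :=
  ContDiffOn.contDiffAt hf ((hJ.prod (hI.prod hU)).mem_nhds ⟨hu, hr, hp⟩)

theorem hasFDerivAt (hf : SmoothField J I U f) {u r : ℝ} {p : Plane} (hu : u ∈ J) (hr : r ∈ I)
    (hp : p ∈ U) : HasFDerivAt (fun y : ℝ × ℝ × Plane => f y.1 y.2.1 y.2.2)
      (fderiv ℝ (fun y : ℝ × ℝ × Plane => f y.1 y.2.1 y.2.2) (u, r, p)) (u, r, p) :=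
  ((hf.contDiffAt hJ hI hU hu hr hp).differentiableAt (by simp)).hasFDerivAt

theorem dirDeriv (hf : SmoothField J I U f) (v : ℝ × ℝ × Plane) :
    SmoothField J I U (dirDeriv v f) :=
  (ContDiffOn.fderiv_of_isOpen hf (hJ.prod (hI.prod hU)) (by simp)).clm_apply contDiffOn_const

/-- Symmetry of the second Fréchet derivative. All commutation rules for `pu`, `pr` and `pd` below
reduce to it, by viewing each as a directional derivative on the product. -/
theorem dirDeriv_comm (hf : SmoothField J I U f) (v w : ℝ × ℝ × Plane) {u r : ℝ} {p : Plane}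
    (hu : u ∈ J) (hr : r ∈ I) (hp : p ∈ U) :
    BondiGluing.dirDeriv v (BondiGluing.dirDeriv w f) u r p =
      BondiGluing.dirDeriv w (BondiGluing.dirDeriv v f) u r p := by
  have hc := hf.contDiffAt hJ hI hU hu hr hp
  have hd : DifferentiableAt ℝ
      (fderiv ℝ (fun y : ℝ × ℝ × Plane => f y.1 y.2.1 y.2.2)) (u, r, p) :=
    (hc.fderiv_right (m := ∞) (by simp)).differentiableAt (by simp)
  have key : ∀ v w : ℝ × ℝ × Plane,
      BondiGluing.dirDeriv v (BondiGluing.dirDeriv w f) u r p =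
        fderiv ℝ (fderiv ℝ (fun y : ℝ × ℝ × Plane => f y.1 y.2.1 y.2.2)) (u, r, p) v w := by
    intro v w
    refine (congrArg (fun L : (ℝ × ℝ × Plane) →L[ℝ] ℝ => L v)
      (hd.hasFDerivAt.clm_apply (hasFDerivAt_const w _)).fderiv).trans ?_
    simp
  rw [key, key]
  exact (hc.isSymmSndFDerivAt (by simpa using! (mod_cast le_top : ((2 : ℕ∞) : WithTop ℕ∞) ≤ ∞))) v w

theorem hasDerivAt_u' (hf : SmoothField J I U f) {u r : ℝ} {p : Plane} (hu : u ∈ J) (hr : r ∈ I)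
    (hp : p ∈ U) :
    HasDerivAt (fun v => f v r p) (BondiGluing.dirDeriv (1, 0, 0) f u r p) u :=
  (hf.hasFDerivAt hJ hI hU hu hr hp).comp_hasDerivAt (f := fun v => (v, r, p)) u
    ((hasDerivAt_id u).prodMk ((hasDerivAt_const u r).prodMk (hasDerivAt_const u p)))

theorem hasDerivAt_r' (hf : SmoothField J I U f) {u r : ℝ} {p : Plane} (hu : u ∈ J) (hr : r ∈ I)
    (hp : p ∈ U) :
    HasDerivAt (fun s => f u s p) (BondiGluing.dirDeriv (0, 1, 0) f u r p) r :=
  (hf.hasFDerivAt hJ hI hU hu hr hp).comp_hasDerivAt (f := fun s => (u, s, p)) r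
    ((hasDerivAt_const r u).prodMk ((hasDerivAt_id r).prodMk (hasDerivAt_const r p)))

theorem pu_eq (hf : SmoothField J I U f) {u r : ℝ} {p : Plane} (hu : u ∈ J) (hr : r ∈ I)
    (hp : p ∈ U) : BondiGluing.pu f u r p = BondiGluing.dirDeriv (1, 0, 0) f u r p :=
  (hf.hasDerivAt_u' hJ hI hU hu hr hp).deriv

theorem pr_eq (hf : SmoothField J I U f) {u r : ℝ} {p : Plane} (hu : u ∈ J) (hr : r ∈ I)
    (hp : p ∈ U) : BondiGluing.pr f u r p = BondiGluing.dirDeriv (0, 1, 0) f u r p :=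
  (hf.hasDerivAt_r' hJ hI hU hu hr hp).deriv

theorem hasFDerivAt_angular (hf : SmoothField J I U f) {u r : ℝ} {p : Plane} (hu : u ∈ J)
    (hr : r ∈ I) (hp : p ∈ U) : HasFDerivAt (f u r)
      ((fderiv ℝ (fun y : ℝ × ℝ × Plane => f y.1 y.2.1 y.2.2) (u, r, p)).comp
        ((0 : Plane →L[ℝ] ℝ).prod ((0 : Plane →L[ℝ] ℝ).prod (.id ℝ Plane)))) p :=
  (hf.hasFDerivAt hJ hI hU hu hr hp).comp (f := fun q => (u, r, q)) p
    ((hasFDerivAt_const u p).prodMk ((hasFDerivAt_const r p).prodMk (hasFDerivAt_id p)))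

theorem pd_eq (hf : SmoothField J I U f) (A : Fin 2) {u r : ℝ} {p : Plane} (hu : u ∈ J)
    (hr : r ∈ I) (hp : p ∈ U) :
    pd A (f u r) p = BondiGluing.dirDeriv (0, 0, EuclideanSpace.single A 1) f u r p :=
  congrArg (fun L : Plane →L[ℝ] ℝ => L (EuclideanSpace.single A 1))
    (hf.hasFDerivAt_angular hJ hI hU hu hr hp).fderiv

theorem pu (hf : SmoothField J I U f) : SmoothField J I U (BondiGluing.pu f) :=
  (hf.dirDeriv hJ hI hU _).congr fun _ hu _ hr _ hp => hf.pu_eq hJ hI hU hu hr hp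

theorem pr (hf : SmoothField J I U f) : SmoothField J I U (BondiGluing.pr f) :=
  (hf.dirDeriv hJ hI hU _).congr fun _ hu _ hr _ hp => hf.pr_eq hJ hI hU hu hr hp

theorem pd (hf : SmoothField J I U f) (A : Fin 2) :
    SmoothField J I U fun u r p => BondiGluing.pd A (f u r) p :=
  (hf.dirDeriv hJ hI hU _).congr fun _ hu _ hr _ hp => hf.pd_eq hJ hI hU A hu hr hp

theorem hasDerivAt_u (hf : SmoothField J I U f) {u r : ℝ} {p : Plane} (hu : u ∈ J) (hr : r ∈ I)
    (hp : p ∈ U) : HasDerivAt (fun v => f v r p) (BondiGluing.pu f u r p) u :=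
  (hf.hasDerivAt_u' hJ hI hU hu hr hp).differentiableAt.hasDerivAt

theorem hasDerivAt_r (hf : SmoothField J I U f) {u r : ℝ} {p : Plane} (hu : u ∈ J) (hr : r ∈ I)
    (hp : p ∈ U) : HasDerivAt (fun s => f u s p) (BondiGluing.pr f u r p) r :=
  (hf.hasDerivAt_r' hJ hI hU hu hr hp).differentiableAt.hasDerivAt

/-- Partial and directional derivatives are identified only on the open set `J × I × U`; openness
lets such identities be substituted under a further derivative. -/
theorem dirDeriv_congr {v : ℝ × ℝ × Plane}
    (h : ∀ u ∈ J, ∀ r ∈ I, ∀ p ∈ U, f u r p = g u r p) {u r : ℝ} {p : Plane} (hu : u ∈ J)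
    (hr : r ∈ I) (hp : p ∈ U) :
    BondiGluing.dirDeriv v f u r p = BondiGluing.dirDeriv v g u r p := by
  have : (fun y : ℝ × ℝ × Plane => f y.1 y.2.1 y.2.2) =ᶠ[nhds (u, r, p)]
      fun y => g y.1 y.2.1 y.2.2 := by
    filter_upwards [(hJ.prod (hI.prod hU)).mem_nhds ⟨hu, hr, hp⟩] with y hy
    exact h _ hy.1 _ hy.2.1 _ hy.2.2
  exact congrArg (fun L : (ℝ × ℝ × Plane) →L[ℝ] ℝ => L v) this.fderiv_eq

theorem pu_pr_comm (hf : SmoothField J I U f) {u r : ℝ} {p : Plane} (hu : u ∈ J) (hr : r ∈ I)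
    (hp : p ∈ U) :
    BondiGluing.pu (BondiGluing.pr f) u r p = BondiGluing.pr (BondiGluing.pu f) u r p := by
  rw [(hf.pr hJ hI hU).pu_eq hJ hI hU hu hr hp, (hf.pu hJ hI hU).pr_eq hJ hI hU hu hr hp,
    dirDeriv_congr hJ hI hU (fun _ hu _ hr _ hp => hf.pr_eq hJ hI hU hu hr hp) hu hr hp,
    dirDeriv_congr hJ hI hU (fun _ hu _ hr _ hp => hf.pu_eq hJ hI hU hu hr hp) hu hr hp,
    hf.dirDeriv_comm hJ hI hU _ _ hu hr hp]

theorem pu_pd_comm (hf : SmoothField J I U f) (A : Fin 2) {u r : ℝ} {p : Plane} (hu : u ∈ J)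
    (hr : r ∈ I) (hp : p ∈ U) :
    BondiGluing.pu (fun u r p => BondiGluing.pd A (f u r) p) u r p =
      BondiGluing.pd A (BondiGluing.pu f u r) p := by
  rw [(hf.pd hJ hI hU A).pu_eq hJ hI hU hu hr hp, (hf.pu hJ hI hU).pd_eq hJ hI hU A hu hr hp,
    dirDeriv_congr hJ hI hU (fun _ hu _ hr _ hp => hf.pd_eq hJ hI hU A hu hr hp) hu hr hp,
    dirDeriv_congr hJ hI hU (fun _ hu _ hr _ hp => hf.pu_eq hJ hI hU hu hr hp) hu hr hp,
    hf.dirDeriv_comm hJ hI hU _ _ hu hr hp]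

theorem pr_pd_comm (hf : SmoothField J I U f) (A : Fin 2) {u r : ℝ} {p : Plane} (hu : u ∈ J)
    (hr : r ∈ I) (hp : p ∈ U) :
    BondiGluing.pr (fun u r p => BondiGluing.pd A (f u r) p) u r p =
      BondiGluing.pd A (BondiGluing.pr f u r) p := by
  rw [(hf.pd hJ hI hU A).pr_eq hJ hI hU hu hr hp, (hf.pr hJ hI hU).pd_eq hJ hI hU A hu hr hp,
    dirDeriv_congr hJ hI hU (fun _ hu _ hr _ hp => hf.pd_eq hJ hI hU A hu hr hp) hu hr hp,
    dirDeriv_congr hJ hI hU (fun _ hu _ hr _ hp => hf.pr_eq hJ hI hU hu hr hp) hu hr hp,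
    hf.dirDeriv_comm hJ hI hU _ _ hu hr hp]

end Derivatives

end SmoothField

/-! ### Locality, linearity and parameter derivatives of the tensor operators. -/

section Operators

variable (G : Tensor2)

theorem pd_congr {U : Set Plane} (hU : IsOpen U) {f g : Plane → ℝ} (h : ∀ q ∈ U, f q = g q)
    (A : Fin 2) {p : Plane} (hp : p ∈ U) : pd A f p = pd A g p := by
  have : f =ᶠ[nhds p] g := by
    filter_upwards [hU.mem_nhds hp] with q hq using h q hq
  simp only [pd, this.fderiv_eq]

/-- Over a field the derivative commutes with scaling even where `f` is not differentiable, so the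
scaling rules below need no regularity, unlike additivity. -/
theorem pd_const_mul (c : ℝ) (f : Plane → ℝ) (A : Fin 2) (p : Plane) :
    pd A (fun q => c * f q) p = c * pd A f p := by
  have : (fun q => c * f q) = c • f := rfl
  simp [pd, this, fderiv_const_smul_field]

theorem pd_add {f g : Plane → ℝ} {p : Plane} (hf : DifferentiableAt ℝ f p)
    (hg : DifferentiableAt ℝ g p) (A : Fin 2) :
    pd A (fun q => f q + g q) p = pd A f p + pd A g p := by
  simp [pd, fderiv_fun_add hf hg]

theorem covD_congr {U : Set Plane} (hU : IsOpen U) {w w' : Covec}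
    (h : ∀ A, ∀ q ∈ U, w A q = w' A q) (A B : Fin 2) {p : Plane} (hp : p ∈ U) :
    covD G w A B p = covD G w' A B p := by
  simp only [covD, pd_congr hU (h B) A hp, h _ p hp]

theorem div₂_congr {U : Set Plane} (hU : IsOpen U) {t t' : Tensor2}
    (h : ∀ A B, ∀ q ∈ U, t A B q = t' A B q) (A : Fin 2) {p : Plane} (hp : p ∈ U) :
    div₂ G t A p = div₂ G t' A p := by
  simp only [div₂, covD₂, pd_congr hU (h _ _) _ hp, h _ _ p hp]

theorem TS_congr {t t' : Tensor2} {p : Plane} (h : ∀ A B, t A B p = t' A B p) (A B : Fin 2) :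
    TS G t A B p = TS G t' A B p := by
  simp only [TS, trace, h]

theorem covD_const_mul (c : ℝ) (w : Covec) (A B : Fin 2) (p : Plane) :
    covD G (fun C q => c * w C q) A B p = c * covD G w A B p := by
  simp only [covD, pd_const_mul, Fin.sum_univ_two]
  ring

theorem covD_add {w w' : Covec} {p : Plane} (hw : ∀ A, DifferentiableAt ℝ (w A) p)
    (hw' : ∀ A, DifferentiableAt ℝ (w' A) p) (A B : Fin 2) :
    covD G (fun C q => w C q + w' C q) A B p = covD G w A B p + covD G w' A B p := by
  simp only [covD, pd_add (hw _) (hw' _), Fin.sum_univ_two]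
  ring

theorem div₂_const_mul (c : ℝ) (t : Tensor2) (A : Fin 2) (p : Plane) :
    div₂ G (fun C B q => c * t C B q) A p = c * div₂ G t A p := by
  simp only [div₂, covD₂, pd_const_mul, Fin.sum_univ_two]
  ring

theorem TS_const_mul_add (c d : ℝ) (t t' : Tensor2) (A B : Fin 2) (p : Plane) :
    TS G (fun C D q => c * t C D q + d * t' C D q) A B p = c * TS G t A B p + d * TS G t' A B p := by
  simp only [TS, trace, Fin.sum_univ_two]
  ring

/-- The coefficients do not depend on the parameter, so only the exchange of `pd` with the parameter
derivative, assumed in `h1`, is at stake. The divergence is treated in the same way. -/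
theorem hasDerivAt_covD {w : ℝ → Covec} {w' : Covec} {s : ℝ} {p : Plane}
    (h0 : ∀ A, HasDerivAt (fun s => w s A p) (w' A p) s)
    (h1 : ∀ C A, HasDerivAt (fun s => pd C (w s A) p) (pd C (w' A) p) s) (A B : Fin 2) :
    HasDerivAt (fun s => covD G (w s) A B p) (covD G w' A B p) s :=
  (h1 A B).sub (HasDerivAt.fun_sum fun C _ => (h0 C).const_mul _)

theorem hasDerivAt_div₂ {t : ℝ → Tensor2} {t' : Tensor2} {s : ℝ} {p : Plane}
    (h0 : ∀ A B, HasDerivAt (fun s => t s A B p) (t' A B p) s)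
    (h1 : ∀ C A B, HasDerivAt (fun s => pd C (t s A B) p) (pd C (t' A B) p) s) (A : Fin 2) :
    HasDerivAt (fun s => div₂ G (t s) A p) (div₂ G t' A p) s :=
  HasDerivAt.fun_sum fun B _ => HasDerivAt.fun_sum fun C _ => HasDerivAt.const_mul _ <|
    ((h1 C A B).sub (HasDerivAt.fun_sum fun D _ => (h0 D B).const_mul _)).sub
      (HasDerivAt.fun_sum fun D _ => (h0 A D).const_mul _)

theorem hasDerivAt_TS {t : ℝ → Tensor2} {t' : Tensor2} {s : ℝ} {p : Plane}
    (h0 : ∀ A B, HasDerivAt (fun s => t s A B p) (t' A B p) s) (A B : Fin 2) :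
    HasDerivAt (fun s => TS G (t s) A B p) (TS G t' A B p) s :=
  (((h0 A B).add (h0 B A)).sub ((HasDerivAt.fun_sum fun C _ => HasDerivAt.fun_sum fun D _ =>
    (h0 C D).const_mul _).mul_const _)).const_mul _

end Operators

/-! ### Tensor operators on smooth fields and their commutation with `∂_u` and `∂_r`. -/

namespace SmoothField

variable {J I : Set ℝ} {U : Set Plane} {G : Tensor2}
  {W : Fin 2 → ℝ → ℝ → Plane → ℝ} {T : Fin 2 → Fin 2 → ℝ → ℝ → Plane → ℝ}

theorem TS (hG : IsSmoothMetricOn G U) (hT : ∀ A B, SmoothField J I U (T A B)) (A B : Fin 2) :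
    SmoothField J I U fun u r p => BondiGluing.TS G (fun C D q => T C D u r q) A B p :=
  (of_radial contDiffOn_const).mul <| ((hT A B).add (hT B A)).sub <|
    (sum fun C _ => sum fun D _ => (of_angular (hG.contDiffOn_invMetric C D)).mul (hT C D)).mul
      (of_angular (hG.contDiffOn A B))

variable (hJ : IsOpen J) (hI : IsOpen I) (hU : IsOpen U)
include hJ hI hU

theorem hasDerivAt_u_pd {f : ℝ → ℝ → Plane → ℝ} (hf : SmoothField J I U f) (A : Fin 2)
    {u r : ℝ} {p : Plane} (hu : u ∈ J) (hr : r ∈ I) (hp : p ∈ U) :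
    HasDerivAt (fun v => BondiGluing.pd A (f v r) p)
      (BondiGluing.pd A (BondiGluing.pu f u r) p) u := by
  rw [← hf.pu_pd_comm hJ hI hU A hu hr hp]
  exact (hf.pd hJ hI hU A).hasDerivAt_u hJ hI hU hu hr hp

theorem hasDerivAt_r_pd {f : ℝ → ℝ → Plane → ℝ} (hf : SmoothField J I U f) (A : Fin 2)
    {u r : ℝ} {p : Plane} (hu : u ∈ J) (hr : r ∈ I) (hp : p ∈ U) :
    HasDerivAt (fun s => BondiGluing.pd A (f u s) p)
      (BondiGluing.pd A (BondiGluing.pr f u r) p) r := by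
  rw [← hf.pr_pd_comm hJ hI hU A hu hr hp]
  exact (hf.pd hJ hI hU A).hasDerivAt_r hJ hI hU hu hr hp

theorem hasDerivAt_u_pr {f : ℝ → ℝ → Plane → ℝ} (hf : SmoothField J I U f)
    {u r : ℝ} {p : Plane} (hu : u ∈ J) (hr : r ∈ I) (hp : p ∈ U) :
    HasDerivAt (fun v => BondiGluing.pr f v r p)
      (BondiGluing.pr (BondiGluing.pu f) u r p) u := by
  rw [← hf.pu_pr_comm hJ hI hU hu hr hp]
  exact (hf.pr hJ hI hU).hasDerivAt_u hJ hI hU hu hr hp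

theorem pr_congr {f g : ℝ → ℝ → Plane → ℝ} (h : ∀ u ∈ J, ∀ r ∈ I, ∀ p ∈ U, f u r p = g u r p)
    (hf : SmoothField J I U f)
    {u r : ℝ} {p : Plane} (hu : u ∈ J) (hr : r ∈ I) (hp : p ∈ U) :
    BondiGluing.pr f u r p = BondiGluing.pr g u r p := by
  rw [hf.pr_eq hJ hI hU hu hr hp,
    (hf.congr fun u hu r hr p hp => (h u hu r hr p hp).symm).pr_eq hJ hI hU hu hr hp]
  exact dirDeriv_congr hJ hI hU h hu hr hp

theorem hasDerivAt_u_pr_pr {f : ℝ → ℝ → Plane → ℝ} (hf : SmoothField J I U f)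
    {u r : ℝ} {p : Plane} (hu : u ∈ J) (hr : r ∈ I) (hp : p ∈ U) :
    HasDerivAt (fun v => BondiGluing.pr (BondiGluing.pr f) v r p)
      (BondiGluing.pr (BondiGluing.pr (BondiGluing.pu f)) u r p) u := by
  rw [← pr_congr hJ hI hU (fun _ hu _ hr _ hp => hf.pu_pr_comm hJ hI hU hu hr hp)
    ((hf.pr hJ hI hU).pu hJ hI hU) hu hr hp]
  exact (hf.pr hJ hI hU).hasDerivAt_u_pr hJ hI hU hu hr hp

theorem covD (hG : IsSmoothMetricOn G U) (hW : ∀ A, SmoothField J I U (W A)) (A B : Fin 2) :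
    SmoothField J I U fun u r p => BondiGluing.covD G (fun C q => W C u r q) A B p :=
  ((hW B).pd hJ hI hU A).sub
    (sum fun C _ => (of_angular (hG.contDiffOn_christoffel hU C A B)).mul (hW C))

theorem div₂ (hG : IsSmoothMetricOn G U) (hT : ∀ A B, SmoothField J I U (T A B)) (A : Fin 2) :
    SmoothField J I U fun u r p => BondiGluing.div₂ G (fun C B q => T C B u r q) A p :=
  sum fun B _ => sum fun C _ => (of_angular (hG.contDiffOn_invMetric B C)).mul <|
    (((hT A B).pd hJ hI hU C).sub (sum fun D _ =>
      (of_angular (hG.contDiffOn_christoffel hU D C A)).mul (hT D B))).sub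
      (sum fun D _ => (of_angular (hG.contDiffOn_christoffel hU D C B)).mul (hT A D))

theorem TS_covD (hG : IsSmoothMetricOn G U) (hW : ∀ A, SmoothField J I U (W A)) (A B : Fin 2) :
    SmoothField J I U fun u r p =>
      BondiGluing.TS G (BondiGluing.covD G fun C q => W C u r q) A B p :=
  TS hG (fun A B => covD hJ hI hU hG hW A B) A B

theorem hasDerivAt_r_div₂ (hT : ∀ A B, SmoothField J I U (T A B)) (A : Fin 2)
    {u r : ℝ} {p : Plane} (hu : u ∈ J) (hr : r ∈ I) (hp : p ∈ U) :
    HasDerivAt (fun s => BondiGluing.div₂ G (fun C B q => T C B u s q) A p)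
      (BondiGluing.div₂ G (fun C B q => BondiGluing.pr (T C B) u r q) A p) r :=
  hasDerivAt_div₂ G (fun A B => (hT A B).hasDerivAt_r hJ hI hU hu hr hp)
    (fun C A B => (hT A B).hasDerivAt_r_pd hJ hI hU C hu hr hp) A

theorem hasDerivAt_u_div₂ (hT : ∀ A B, SmoothField J I U (T A B)) (A : Fin 2)
    {u r : ℝ} {p : Plane} (hu : u ∈ J) (hr : r ∈ I) (hp : p ∈ U) :
    HasDerivAt (fun v => BondiGluing.div₂ G (fun C B q => T C B v r q) A p)
      (BondiGluing.div₂ G (fun C B q => BondiGluing.pu (T C B) u r q) A p) u :=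
  hasDerivAt_div₂ G (fun A B => (hT A B).hasDerivAt_u hJ hI hU hu hr hp)
    (fun C A B => (hT A B).hasDerivAt_u_pd hJ hI hU C hu hr hp) A

theorem hasDerivAt_r_TS_covD (hW : ∀ A, SmoothField J I U (W A)) (A B : Fin 2)
    {u r : ℝ} {p : Plane} (hu : u ∈ J) (hr : r ∈ I) (hp : p ∈ U) :
    HasDerivAt (fun s => BondiGluing.TS G (BondiGluing.covD G fun C q => W C u s q) A B p)
      (BondiGluing.TS G (BondiGluing.covD G fun C q => BondiGluing.pr (W C) u r q) A B p) r :=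
  hasDerivAt_TS G (hasDerivAt_covD G (fun A => (hW A).hasDerivAt_r hJ hI hU hu hr hp)
    fun C A => (hW A).hasDerivAt_r_pd hJ hI hU C hu hr hp) A B

theorem hasDerivAt_u_TS_covD (hW : ∀ A, SmoothField J I U (W A)) (A B : Fin 2)
    {u r : ℝ} {p : Plane} (hu : u ∈ J) (hr : r ∈ I) (hp : p ∈ U) :
    HasDerivAt (fun v => BondiGluing.TS G (BondiGluing.covD G fun C q => W C v r q) A B p)
      (BondiGluing.TS G (BondiGluing.covD G fun C q => BondiGluing.pu (W C) u r q) A B p) u :=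
  hasDerivAt_TS G (hasDerivAt_covD G (fun A => (hW A).hasDerivAt_u hJ hI hU hu hr hp)
    fun C A => (hW A).hasDerivAt_u_pd hJ hI hU C hu hr hp) A B

theorem hasDerivAt_r_opP (hG : IsSmoothMetricOn G U) (hT : ∀ A B, SmoothField J I U (T A B))
    (A B : Fin 2) {u r : ℝ} {p : Plane} (hu : u ∈ J) (hr : r ∈ I) (hp : p ∈ U) :
    HasDerivAt (fun s => opP G (fun C D q => T C D u s q) A B p)
      (opP G (fun C D q => BondiGluing.pr (T C D) u r q) A B p) r := by
  have h := hasDerivAt_r_TS_covD (G := G) hJ hI hU (fun A => div₂ hJ hI hU hG hT A) A B hu hr hp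
  -- The inner exchange of `∂_r` with the divergence is needed on all of `U`, because the outer
  -- covariant derivative differentiates it in the angular directions.
  refine h.congr_deriv (TS_congr G (fun A B => covD_congr G hU (fun A q hq => ?_) A B hp) A B)
  exact (hasDerivAt_r_div₂ hJ hI hU hT A hu hr hq).deriv

end SmoothField

/-- Agreement on the whole open set `J` is what the induction carries, since the next derivative
depends on values near `u`. -/
theorem iteratedDeriv_eq_of_hasDerivAt {J : Set ℝ} (hJ : IsOpen J) {F : ℝ → ℝ} {g : ℕ → ℝ → ℝ}
    (h0 : ∀ u ∈ J, F u = g 0 u) (hs : ∀ i, ∀ u ∈ J, HasDerivAt (g i) (g (i + 1) u) u) (i : ℕ) :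
    ∀ u ∈ J, iteratedDeriv i F u = g i u := by
  induction i with
  | zero => simpa using h0
  | succ i ih =>
    intro u hu
    have hev : iteratedDeriv i F =ᶠ[nhds u] g i := by
      filter_upwards [hJ.mem_nhds hu] with v hv using ih v hv
    rw [iteratedDeriv_succ, hev.deriv_eq, (hs i u hu).deriv]

/-! ### The `u`-differentiated field equations in expanded form. -/

namespace BondiPerturbation

variable {S : Type*} [TopologicalSpace S] [ChartedSpace Plane S] [IsManifold (𝓡 2) ∞ S]
  {b : Background S} {J I : Set ℝ} (h : BondiPerturbation b J I)
  (φ : OpenPartialHomeomorph S Plane)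

/-- `∂_u^i ȟ_{uA}` as a function of `(u, r, x^A)`. -/
def fieldA (i : ℕ) (A : Fin 2) (u r : ℝ) (p : Plane) : ℝ := h.duChkuA φ i u r A p

/-- `∂_u^i ȟ_{AB}` as a function of `(u, r, x^A)`. -/
def fieldAB (i : ℕ) (A B : Fin 2) (u r : ℝ) (p : Plane) : ℝ := h.duChkAB φ i u r A B p

theorem fieldA_succ (i : ℕ) (A : Fin 2) : h.fieldA φ (i + 1) A = pu (h.fieldA φ i A) := by
  funext u r p
  simp only [fieldA, duChkuA, iteratedDeriv_succ]
  rfl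

theorem fieldAB_succ (i : ℕ) (A B : Fin 2) :
    h.fieldAB φ (i + 1) A B = pu (h.fieldAB φ i A B) := by
  funext u r p
  simp only [fieldAB, duChkAB, iteratedDeriv_succ]
  rfl

/-- Left-hand side minus right-hand side of the `i`-th `u`-derivative of `δG_{rA} = 0`, with the
radial derivatives expanded. -/
def expandedRA (i : ℕ) (A : Fin 2) (u r : ℝ) (p : Plane) : ℝ :=
  4 * r ^ 3 * pr (h.fieldA φ i A) u r p + r ^ 4 * pr (pr (h.fieldA φ i A)) u r p
    - r ^ 2 * div₂ (b.G φ) (fun C B q => pr (h.fieldAB φ i C B) u r q) A p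

/-- The `i`-th `u`-derivative of `TS[δG_{AB}]`, with the radial derivatives expanded. -/
def expandedTS (i : ℕ) (A B : Fin 2) (u r : ℝ) (p : Plane) : ℝ :=
  h.fieldAB φ (i + 1) A B u r p + r * pr (h.fieldAB φ (i + 1) A B) u r p
    - (1 / 2) * (b.ε - 3 * b.αsq * r ^ 2) * pr (h.fieldAB φ i A B) u r p
    - (1 / 2) * b.V r * pr (pr (h.fieldAB φ i A B)) u r p
    - b.V r / (2 * r) * pr (h.fieldAB φ i A B) u r p
    - 2 * TS (b.G φ) (covD (b.G φ) fun C q => h.fieldA φ i C u r q) A B p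
    - r * TS (b.G φ) (covD (b.G φ) fun C q => pr (h.fieldA φ i C) u r q) A B p

theorem _root_.BondiGluing.Background.hasDerivAt_V (b : Background S) (r : ℝ) :
    HasDerivAt b.V (b.ε - 3 * b.αsq * r ^ 2) r := by
  have := (((hasDerivAt_id r).const_mul b.ε).sub
    ((hasDerivAt_pow 3 r).const_mul b.αsq)).sub_const (2 * b.m)
  refine this.congr_deriv ?_
  simp
  ring

theorem _root_.BondiGluing.Background.contDiff_V (b : Background S) : ContDiff ℝ ∞ b.V := by
  unfold Background.V
  fun_prop

section Smooth

variable (hJ : IsOpen J) (hI : IsOpen I) (hIpos : I ⊆ Set.Ioi 0)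
  (hφ : φ ∈ IsManifold.maximalAtlas (𝓡 2) ∞ S)
include hJ hI hIpos hφ

theorem smoothField_fieldA (i : ℕ) (A : Fin 2) :
    SmoothField J I φ.target (h.fieldA φ i A) := by
  induction i with
  | zero =>
    have hinv : SmoothField J I φ.target fun _ r _ => (r ^ 2)⁻¹ :=
      SmoothField.of_radial ((contDiff_id.pow 2).contDiffOn.inv fun r hr =>
        pow_ne_zero 2 (hIpos hr).ne')
    have h0 : SmoothField J I φ.target fun u r p => comp₁ φ (h.hu u r) A p := h.smooth_hu φ hφ A
    refine (h0.mul hinv).congr fun u _ r _ p _ => ?_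
    simp [fieldA, duChkuA, chkuA, huA, div_eq_mul_inv]
  | succ i ih =>
    rw [fieldA_succ]
    exact ih.pu hJ hI φ.open_target

theorem smoothField_fieldAB (i : ℕ) (A B : Fin 2) :
    SmoothField J I φ.target (h.fieldAB φ i A B) := by
  induction i with
  | zero =>
    have hinv : SmoothField J I φ.target fun _ r _ => (r ^ 2)⁻¹ :=
      SmoothField.of_radial ((contDiff_id.pow 2).contDiffOn.inv fun r hr =>
        pow_ne_zero 2 (hIpos hr).ne')
    have h0 : SmoothField J I φ.target fun u r p => comp₂ φ (h.hS u r) A B p :=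
      h.smooth_hS φ hφ A B
    refine (h0.mul hinv).congr fun u _ r _ p _ => ?_
    simp [fieldAB, duChkAB, chkAB, hAB, div_eq_mul_inv]
  | succ i ih =>
    rw [fieldAB_succ]
    exact ih.pu hJ hI φ.open_target

theorem eqRA_eq {u r : ℝ} (hu : u ∈ J) (hr : r ∈ I) {p : Plane} (hp : p ∈ φ.target) (A : Fin 2) :
    h.eqRA φ u r A p = h.expandedRA φ 0 A u r p := by
  have hW := h.smoothField_fieldA φ hJ hI hIpos hφ 0 A
  have h1 := (hasDerivAt_pow 4 r).mul
    ((hW.pr hJ hI φ.open_target).hasDerivAt_r hJ hI φ.open_target hu hr hp)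
  have h2 : (fun t u r p => h.chkuA φ u r t p) = fun t => h.fieldA φ 0 t := by
    funext A u r p; simp [fieldA, duChkuA]
  have h3 : (fun A B u r p => h.chkAB φ u r A B p) = fun A B => h.fieldAB φ 0 A B := by
    funext A B u r p; simp [fieldAB, duChkAB]
  have e : h.eqRA φ u r A p = deriv (fun s => s ^ 4 * pr (h.fieldA φ 0 A) u s p) r
      - div₂ (b.G φ) (fun C B q => r ^ 2 * pr (h.fieldAB φ 0 C B) u r q) A p := by
    rw [← congrFun h2 A]
    simp only [← fun C B => congrFun (congrFun h3 C) B]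
    rfl
  rw [e, div₂_const_mul, expandedRA]
  refine congrArg (· - _) (h1.deriv.trans ?_)
  push_cast
  ring

theorem hasDerivAt_expandedRA (i : ℕ) {u r : ℝ} (hu : u ∈ J) (hr : r ∈ I) {p : Plane}
    (hp : p ∈ φ.target) (A : Fin 2) :
    HasDerivAt (fun v => h.expandedRA φ i A v r p) (h.expandedRA φ (i + 1) A u r p) u := by
  have hU := φ.open_target
  have hW := h.smoothField_fieldA φ hJ hI hIpos hφ i A
  have hT := h.smoothField_fieldAB φ hJ hI hIpos hφ i
  have hd := SmoothField.hasDerivAt_u_div₂ (G := b.G φ) hJ hI hU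
    (fun C B => (hT C B).pr hJ hI hU) A hu hr hp
  have := (((hW.hasDerivAt_u_pr hJ hI hU hu hr hp).const_mul (4 * r ^ 3)).add
    ((hW.hasDerivAt_u_pr_pr hJ hI hU hu hr hp).const_mul (r ^ 4))).sub (hd.const_mul (r ^ 2))
  refine this.congr_deriv ?_
  simp only [expandedRA, fieldA_succ, fieldAB_succ]
  rw [div₂_congr _ hU (fun C B q hq => (hT C B).pu_pr_comm hJ hI hU hu hr hq) A hp]

theorem iteratedDeriv_eqRA (i : ℕ) {u r : ℝ} (hu : u ∈ J) (hr : r ∈ I) {p : Plane}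
    (hp : p ∈ φ.target) (A : Fin 2) :
    iteratedDeriv i (fun v => h.eqRA φ v r A p) u = h.expandedRA φ i A u r p :=
  iteratedDeriv_eq_of_hasDerivAt (g := fun i v => h.expandedRA φ i A v r p) hJ
    (fun _ hv => h.eqRA_eq φ hJ hI hIpos hφ hv hr hp A)
    (fun j _ hv => h.hasDerivAt_expandedRA φ hJ hI hIpos hφ j hv hr hp A) i u hu

theorem eqTS_eq {u r : ℝ} (hu : u ∈ J) (hr : r ∈ I) {p : Plane} (hp : p ∈ φ.target)
    (A B : Fin 2) : h.eqTS φ u r A B p = h.expandedTS φ 0 A B u r p := by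
  have hU := φ.open_target
  have hr0 : r ≠ 0 := (hIpos hr).ne'
  have hW := h.smoothField_fieldA φ hJ hI hIpos hφ 0
  have hT := h.smoothField_fieldAB φ hJ hI hIpos hφ 0 A B
  have hT' := h.smoothField_fieldAB φ hJ hI hIpos hφ 1 A B
  have h2 : (fun u r p => h.chkAB φ u r A B p) = h.fieldAB φ 0 A B := by
    funext u r p; simp [fieldAB, duChkAB]
  have h3 : (fun u r A p => h.chkuA φ u r A p) = fun u r A p => h.fieldA φ 0 A u r p := by
    funext u r A p; simp [fieldA, duChkuA]
  -- The derivative of `V / s` is left unevaluated: the term `-½ (V/r)' ȟ_{AB}` from the product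
  -- rule cancels against the last `V`-term of the equation.
  have hVs : HasDerivAt (fun s => b.V s / s) (deriv (fun s => b.V s / s) r) r :=
    ((b.hasDerivAt_V r).differentiableAt.fun_div differentiableAt_fun_id hr0).hasDerivAt
  have e : h.eqTS φ u r A B p = deriv (fun s => s * h.fieldAB φ 1 A B u s p
        - (1 / 2) * b.V s * pr (h.fieldAB φ 0 A B) u s p
        - (1 / 2) * (b.V s / s) * h.fieldAB φ 0 A B u s p
        - s * TS (b.G φ) (covD (b.G φ) fun C q => h.fieldA φ 0 C u s q) A B p) r
      + (1 / 2) * deriv (fun s => b.V s / s) r * h.fieldAB φ 0 A B u r p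
      - r⁻¹ * (r * TS (b.G φ) (covD (b.G φ) fun C q => h.fieldA φ 0 C u r q) A B p) := by
    have hV : ∀ s, (1 / 2) * (b.V s / s) = b.V s / (2 * s) := fun s => by
      rw [div_mul_div_comm, one_mul]
    simp only [hV]
    rw [fieldAB_succ, ← h2]
    change _ = deriv (fun s => s * _ - _ - _ -
      s * TS _ (covD _ ((fun u r A p => h.fieldA φ 0 A u r p) u s)) A B p) r + _
      - _ * (r * TS _ (covD _ ((fun u r A p => h.fieldA φ 0 A u r p) u r)) A B p)
    rw [← h3]
    rfl
  have hD := ((((hasDerivAt_id r).mul (hT'.hasDerivAt_r hJ hI hU hu hr hp)).sub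
    (((b.hasDerivAt_V r).const_mul (1 / 2)).mul
      ((hT.pr hJ hI hU).hasDerivAt_r hJ hI hU hu hr hp))).sub
    ((hVs.const_mul (1 / 2)).mul (hT.hasDerivAt_r hJ hI hU hu hr hp))).sub
    ((hasDerivAt_id r).mul
      (SmoothField.hasDerivAt_r_TS_covD (G := b.G φ) hJ hI hU hW A B hu hr hp))
  rw [e, expandedTS, inv_mul_cancel_left₀ hr0]
  refine (congrArg (fun x => x + _ - _) hD.deriv).trans ?_
  simp only [id]
  rw [← div_div, mul_comm (b.V r / 2 / r)]
  ring

/-- At fixed `r` the expanded equation is linear in the fields with `u`-independent coefficients, so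
`∂_u` only raises the index `i`. -/
theorem hasDerivAt_expandedTS (i : ℕ) {u r : ℝ} (hu : u ∈ J) (hr : r ∈ I) {p : Plane}
    (hp : p ∈ φ.target) (A B : Fin 2) :
    HasDerivAt (fun v => h.expandedTS φ i A B v r p) (h.expandedTS φ (i + 1) A B u r p) u := by
  have hU := φ.open_target
  have hW := h.smoothField_fieldA φ hJ hI hIpos hφ i
  have hT := h.smoothField_fieldAB φ hJ hI hIpos hφ i A B
  have hT' := h.smoothField_fieldAB φ hJ hI hIpos hφ (i + 1) A B
  have := ((((((hT'.hasDerivAt_u hJ hI hU hu hr hp).add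
    ((hT'.hasDerivAt_u_pr hJ hI hU hu hr hp).const_mul r)).sub
    ((hT.hasDerivAt_u_pr hJ hI hU hu hr hp).const_mul
      ((1 / 2) * (b.ε - 3 * b.αsq * r ^ 2)))).sub
    ((hT.hasDerivAt_u_pr_pr hJ hI hU hu hr hp).const_mul ((1 / 2) * b.V r))).sub
    ((hT.hasDerivAt_u_pr hJ hI hU hu hr hp).const_mul (b.V r / (2 * r)))).sub
    ((SmoothField.hasDerivAt_u_TS_covD (G := b.G φ) hJ hI hU hW A B hu hr hp).const_mul 2)).sub
    ((SmoothField.hasDerivAt_u_TS_covD (G := b.G φ) hJ hI hU (fun C => (hW C).pr hJ hI hU) A B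
      hu hr hp).const_mul r)
  refine this.congr_deriv ?_
  rw [TS_congr (b.G φ) (fun C D => covD_congr (b.G φ) hU
    (fun E q hq => (hW E).pu_pr_comm hJ hI hU hu hr hq) C D hp) A B]
  simp only [expandedTS, fieldA_succ, fieldAB_succ]

theorem iteratedDeriv_eqTS (i : ℕ) {u r : ℝ} (hu : u ∈ J) (hr : r ∈ I) {p : Plane}
    (hp : p ∈ φ.target) (A B : Fin 2) :
    iteratedDeriv i (fun v => h.eqTS φ v r A B p) u = h.expandedTS φ i A B u r p :=
  iteratedDeriv_eq_of_hasDerivAt (g := fun i v => h.expandedTS φ i A B v r p) hJ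
    (fun _ hv => h.eqTS_eq φ hJ hI hIpos hφ hv hr hp A B)
    (fun j _ hv => h.hasDerivAt_expandedTS φ hJ hI hIpos hφ j hv hr hp A B) i u hu

end Smooth

end BondiPerturbation

/-! ### Radial derivative of the charge. -/

namespace BondiPerturbation

variable {S : Type*} [TopologicalSpace S] [ChartedSpace Plane S] [IsManifold (𝓡 2) ∞ S]
  {b : Background S} {J I : Set ℝ} (h : BondiPerturbation b J I)
  (φ : OpenPartialHomeomorph S Plane)

/-- The tensor field of which `Q^{3,i+1}_A` contains the divergence, with the radial derivative of
`r⁴ TS[D_A ∂_u^i ȟ_{uB}]` expanded. -/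
def chargeTensor (i : ℕ) (A B : Fin 2) (u r : ℝ) (p : Plane) : ℝ :=
  2 * r * h.fieldAB φ (i + 1) A B u r p - b.V r * pr (h.fieldAB φ i A B) u r p
    - (4 * r * TS (b.G φ) (covD (b.G φ) fun C q => h.fieldA φ i C u r q) A B p
      + r ^ 2 * TS (b.G φ) (covD (b.G φ) fun C q => pr (h.fieldA φ i C) u r q) A B p)
    + (opP (b.G φ) (fun C D q => h.fieldAB φ i C D u r q) A B p
      - b.ε * h.fieldAB φ i A B u r p)

section Smooth

variable (hJ : IsOpen J) (hI : IsOpen I) (hIpos : I ⊆ Set.Ioi 0)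
  (hφ : φ ∈ IsManifold.maximalAtlas (𝓡 2) ∞ S)
include hJ hI hIpos hφ

/-- Needed to move `∂_r` through the divergence of the charge tensor. -/
theorem smoothField_chargeTensor (i : ℕ) (A B : Fin 2) :
    SmoothField J I φ.target (h.chargeTensor φ i A B) := by
  have hU := φ.open_target
  have hG := b.isSmoothMetricOn_G φ hφ
  have hW := h.smoothField_fieldA φ hJ hI hIpos hφ i
  have hT := h.smoothField_fieldAB φ hJ hI hIpos hφ i
  have hT' := h.smoothField_fieldAB φ hJ hI hIpos hφ (i + 1) A B
  have hc : ∀ {c : ℝ → ℝ}, ContDiff ℝ ∞ c → SmoothField J I φ.target fun _ r _ => c r :=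
    fun hc => SmoothField.of_radial hc.contDiffOn
  have hP : SmoothField J I φ.target fun u r p =>
      opP (b.G φ) (fun C D q => h.fieldAB φ i C D u r q) A B p :=
    SmoothField.TS_covD hJ hI hU hG (fun C => SmoothField.div₂ hJ hI hU hG hT C) A B
  exact ((((hc (c := fun r => 2 * r) (by fun_prop)).mul hT').sub
    ((hc b.contDiff_V).mul ((hT A B).pr hJ hI hU))).sub
    (((hc (c := fun r => 4 * r) (by fun_prop)).mul (SmoothField.TS_covD hJ hI hU hG hW A B)).add
      ((hc (c := fun r => r ^ 2) (by fun_prop)).mul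
        (SmoothField.TS_covD hJ hI hU hG (fun C => (hW C).pr hJ hI hU) A B)))).add
    (hP.sub ((hc (c := fun _ => b.ε) (by fun_prop)).mul (hT A B)))

theorem Q3_eq (i : ℕ) {u r : ℝ} (hu : u ∈ J) (hr : r ∈ I) {p : Plane} (hp : p ∈ φ.target)
    (A : Fin 2) :
    h.Q3 φ i u r A p = div₂ (b.G φ) (fun C B q => h.chargeTensor φ i C B u r q) A p
      + b.αsq * r ^ 4 * pr (h.fieldA φ i A) u r p
      + 2 * b.m * (3 * h.fieldA φ i A u r p + r * pr (h.fieldA φ i A) u r p) := by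
  have hU := φ.open_target
  have hr0 : r ≠ 0 := (hIpos hr).ne'
  have hW := h.smoothField_fieldA φ hJ hI hIpos hφ i
  refine congrArg (fun x => x + _ + _) (div₂_congr _ hU (fun C B q hq => ?_) A hp)
  have hD := (hasDerivAt_pow 4 r).mul
    (SmoothField.hasDerivAt_r_TS_covD (G := b.G φ) hJ hI hU hW C B hu hr hq)
  rw [chargeTensor]
  refine congrArg (fun x => _ - x + _) ((congrArg (1 / r ^ 2 * ·) hD.deriv).trans ?_)
  push_cast
  field_simp

omit hJ hI hφ in
theorem div₂_pr_fieldAB (i : ℕ) {u r : ℝ} (hr : r ∈ I) {p : Plane} {A : Fin 2}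
    (hRA : h.expandedRA φ i A u r p = 0) :
    div₂ (b.G φ) (fun C D q => pr (h.fieldAB φ i C D) u r q) A p =
      4 * r * pr (h.fieldA φ i A) u r p + r ^ 2 * pr (pr (h.fieldA φ i A)) u r p := by
  rw [expandedRA] at hRA
  apply mul_left_cancel₀ (pow_ne_zero 2 (hIpos hr).ne')
  linear_combination -hRA

/-- Apply `TS D` to the solved first equation; `r` is constant for the angular derivatives, so the
powers of `r` come out. -/
theorem opP_pr_fieldAB (i : ℕ) {u r : ℝ} (hu : u ∈ J) (hr : r ∈ I)
    (hRA : ∀ p ∈ φ.target, ∀ A, h.expandedRA φ i A u r p = 0) {p : Plane} (hp : p ∈ φ.target)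
    (A B : Fin 2) :
    opP (b.G φ) (fun C D q => pr (h.fieldAB φ i C D) u r q) A B p =
      4 * r * TS (b.G φ) (covD (b.G φ) fun C q => pr (h.fieldA φ i C) u r q) A B p
      + r ^ 2 * TS (b.G φ) (covD (b.G φ) fun C q => pr (pr (h.fieldA φ i C)) u r q) A B p := by
  have hU := φ.open_target
  have hW := h.smoothField_fieldA φ hJ hI hIpos hφ i
  rw [← TS_const_mul_add]
  refine TS_congr _ (fun C D => ?_) A B
  rw [covD_congr _ hU (fun E q hq => h.div₂_pr_fieldAB φ hIpos i hr (hRA q hq E)) C D hp,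
    covD_add, covD_const_mul, covD_const_mul]
  · exact fun E => (((hW E).pr hJ hI hU).hasFDerivAt_angular hJ hI hU hu hr
      hp).differentiableAt.const_mul _
  · exact fun E => ((((hW E).pr hJ hI hU).pr hJ hI hU).hasFDerivAt_angular hJ hI hU hu hr
      hp).differentiableAt.const_mul _

/-- Twice the second equation removes `T'` and the second radial derivative of `T`; the first
equation makes `P T_r` cancel all remaining `W`-terms. What survives is `(V/r - ε) T_r`, which
vanishes when `α² = m = 0`. -/
theorem pr_chargeTensor (i : ℕ) {u r : ℝ} (hu : u ∈ J) (hr : r ∈ I)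
    (hRA : ∀ p ∈ φ.target, ∀ A, h.expandedRA φ i A u r p = 0)
    (hTS : ∀ p ∈ φ.target, ∀ A B, h.expandedTS φ i A B u r p = 0)
    {p : Plane} (hp : p ∈ φ.target) (A B : Fin 2) :
    pr (h.chargeTensor φ i A B) u r p =
      (-b.αsq * r ^ 2 - 2 * b.m / r) * pr (h.fieldAB φ i A B) u r p := by
  have hU := φ.open_target
  have hr0 : r ≠ 0 := (hIpos hr).ne'
  have hG := b.isSmoothMetricOn_G φ hφ
  have hW := h.smoothField_fieldA φ hJ hI hIpos hφ i
  have hT := h.smoothField_fieldAB φ hJ hI hIpos hφ i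
  have hT' := h.smoothField_fieldAB φ hJ hI hIpos hφ (i + 1) A B
  have hD := (((((hasDerivAt_id r).const_mul 2).mul (hT'.hasDerivAt_r hJ hI hU hu hr hp)).sub
    ((b.hasDerivAt_V r).mul (((hT A B).pr hJ hI hU).hasDerivAt_r hJ hI hU hu hr hp))).sub
    ((((hasDerivAt_id r).const_mul 4).mul
      (SmoothField.hasDerivAt_r_TS_covD (G := b.G φ) hJ hI hU hW A B hu hr hp)).add
    ((hasDerivAt_pow 2 r).mul (SmoothField.hasDerivAt_r_TS_covD (G := b.G φ) hJ hI hU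
      (fun C => (hW C).pr hJ hI hU) A B hu hr hp)))).add
    ((SmoothField.hasDerivAt_r_opP hJ hI hU hG hT A B hu hr hp).sub
      (((hT A B).hasDerivAt_r hJ hI hU hu hr hp).const_mul b.ε))
  refine hD.deriv.trans ?_
  have h0 := hTS p hp A B
  rw [expandedTS] at h0
  rw [h.opP_pr_fieldAB φ hJ hI hIpos hφ i hu hr hRA hp A B]
  -- Splitting `V/r` isolates the `ε` that cancels against the `-ε` accompanying `P`.
  have hV : b.V r / (2 * r) = (1 / 2) * (b.ε - b.αsq * r ^ 2 - 2 * b.m / r) := by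
    rw [Background.V]
    field_simp
  rw [hV] at h0
  simp only [id]
  push_cast
  linear_combination 2 * h0

theorem hasDerivAt_Q3 (i : ℕ) {u r : ℝ} (hu : u ∈ J) (hr : r ∈ I)
    (hRA : ∀ p ∈ φ.target, ∀ A, h.expandedRA φ i A u r p = 0)
    (hTS : ∀ p ∈ φ.target, ∀ A B, h.expandedTS φ i A B u r p = 0)
    {p : Plane} (hp : p ∈ φ.target) (A : Fin 2) :
    HasDerivAt (fun s => h.Q3 φ i u s A p) 0 r := by
  have hU := φ.open_target
  have hr0 : r ≠ 0 := (hIpos hr).ne'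
  have hW := h.smoothField_fieldA φ hJ hI hIpos hφ i A
  have hX := h.smoothField_chargeTensor φ hJ hI hIpos hφ i
  have hWr := (hW.pr hJ hI hU).hasDerivAt_r hJ hI hU hu hr hp
  have hD := ((SmoothField.hasDerivAt_r_div₂ (G := b.G φ) hJ hI hU hX A hu hr hp).add
    (((hasDerivAt_pow 4 r).const_mul b.αsq).mul hWr)).add
    ((((hW.hasDerivAt_r hJ hI hU hu hr hp).const_mul 3).add
      ((hasDerivAt_id r).mul hWr)).const_mul (2 * b.m))
  refine (hD.congr_of_eventuallyEq ?_).congr_deriv ?_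
  -- The rewriting of `Q` is an identity valid on the open set `I`, independent of the field
  -- equations, which are used only at `r` itself.
  · filter_upwards [hI.mem_nhds hr] with s hs using h.Q3_eq φ hJ hI hIpos hφ i hu hs hp A
  rw [div₂_congr _ hU (fun C B q hq => h.pr_chargeTensor φ hJ hI hIpos hφ i hu hr hRA hTS hq C B)
    A hp, div₂_const_mul]
  -- Second use of the first equation: `(-α² r² - 2m/r)(4 r W_r + r² W_rr)` cancels the derivatives
  -- of `α² r⁴ W_r` and `2m (3 W + r W_r)`.
  rw [h.div₂_pr_fieldAB φ hIpos i hr (hRA p hp A)]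
  simp only [id]
  push_cast
  field_simp
  ring

end Smooth

end BondiPerturbation

end BondiGluing

end

theorem mainTheorem6 {S : Type*} [TopologicalSpace S] [ChartedSpace BondiGluing.Plane S]
    [IsManifold (𝓡 2) ∞ S]
    (b : BondiGluing.Background S)
    {J I : Set ℝ} (hJ : IsOpen J) (hI : IsOpen I) (hIpos : I ⊆ Set.Ioi 0)
    (h : BondiGluing.BondiPerturbation b J I) (i : ℕ)
    -- the null hypersurface `{u = u₀, r ∈ R}`
    {u₀ : ℝ} (hu₀ : u₀ ∈ J) {R : Set ℝ} (hR : R ⊆ I)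
    -- the local coordinates `x^A` on `S`
    (φ : OpenPartialHomeomorph S BondiGluing.Plane)
    (hφ : φ ∈ IsManifold.maximalAtlas (𝓡 2) ∞ S)
    (hRA : ∀ r ∈ R, ∀ p ∈ φ.target, ∀ A : Fin 2,
      iteratedDeriv i (fun u => h.eqRA φ u r A p) u₀ = 0)
    (hTS : ∀ r ∈ R, ∀ p ∈ φ.target, ∀ A B : Fin 2,
      iteratedDeriv i (fun u => h.eqTS φ u r A B p) u₀ = 0) :
    ∀ r ∈ R, ∀ p ∈ φ.target, ∀ A : Fin 2,
      HasDerivAt (fun s => h.Q3 φ i u₀ s A p) 0 r := by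
  intro r hr p hp A
  refine h.hasDerivAt_Q3 φ hJ hI hIpos hφ i hu₀ (hR hr) (fun q hq A => ?_) (fun q hq A B => ?_) hp A
  · rw [← h.iteratedDeriv_eqRA φ hJ hI hIpos hφ i hu₀ (hR hr) hq A]
    exact hRA r hr q hq A
  · rw [← h.iteratedDeriv_eqTS φ hJ hI hIpos hφ i hu₀ (hR hr) hq A B]
    exact hTS r hr q hq A B
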